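/- Let $\mathbb{N}^*=\{0,0^*,1,1^*,2,\dots\}$, ordered by $0\prec 0^*\prec 1\prec 1^*\prec\cdots$; an element is called starred if it is of the form $x^*$. For $x,y\in\mathbb{N}$ put $x^*\oplus y=x\oplus y^*=(x+y)^*$, $x\oplus y=x+y$, $x^*\oplus y^*=x+y+1$, and $x^*\ominus y=(x-y)^*$, $x^*\ominus y^*=x\ominus y=x-y$, $x\ominus y^*=(x-y-1)^*$. An energy discrete-bidding game $G=\langle V,E,k,w\rangle$ consists of a finite directed graph $(V,E)$ in which every vertex has an out-neighbor, a total budget $k\in\mathbb{N}$, and integer edge weights $w:E\to\mathbb{Z}$. Write $[k]=\{0,0^*,\dots,k,k^*\}$. A configuration $\langle v,B\rangle$ ($v\in V$, $B\in[k]$) means that the token is on $v$, that the budget of the first player, Preserver, is $B$, and that the budget of the second player, Consumer, is $B'=k^*\ominus B$; thus exactly one player holds the advantage (has a starred budget). In each turn both players simultaneously choose a bid that does not exceed their budget, and that may be starred only if they hold the advantage, together with a neighbor of $v$. The higher bidder wins the bidding; if the bids are equal, the player without the advantage wins. The winner moves the token to the neighbor he chose and pays his bid to the other player: if Preserver wins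 with bid $b$, her budget becomes $B\ominus b$, and if Consumer wins with bid $b$, it becomes $B\oplus b$. A (pure) strategy maps each history, i.e. each finite sequence of configurations up to and including the current one, to an allowed action. For an initial energy $M$, a Consumer strategy $M$-wins from a configuration if, against every Preserver strategy, the path $v_0,v_1,\dots$ of the resulting play has some $m\in\mathbb{N}$ with $M+\sum_{0\le j<m}w(v_j,v_{j+1})<0$; a Preserver strategy $M$-wins if, against every Consumer strategy, $M+\sum_{0\le j<m}w(v_j,v_{j+1})\ge 0$ for all $m$. The energy threshold $\mathrm{energy}(v,B)\in\mathbb{N}\cup\{\infty\}$ is the least $M\in\mathbb{N}$ such that Preserver has a strategy that $M$-wins from $\langle v,B\rangle$, and $\infty$ if there is no such $M$. The threshold budget $\mathrm{Th}(v)$ is the least $B\in[k]$ with $\mathrm{energy}(v,B)<\infty$, and $k+1$ if there is none. Consumer's threshold is $\mathrm{Th}'(v)=(k+1)\ominus\mathrm{Th}(v)$. For $B'\in[k]$ with $B'\ge\mathrm{Th}'(v)$, let the trimmed budget $\mathrm{rel}'(v,B')$ be whichever of $\mathrm{Th}'(v)$ and its successor in $\prec$ agrees with $B'$ on being starred. A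 Consumer strategy is budget agnostic if, at histories that end in a vertex $v$ with Consumer budget $B'\ge\mathrm{Th}'(v)$, its bid depends only on $v$ and $\mathrm{rel}'(v,B')$ (so neither on the past nor on the excess budget; the choice of the neighbor is not restricted). **Theorem.** In every energy discrete-bidding game $G=\langle V,E,k,w\rangle$ there is one budget-agnostic Consumer strategy that, for every configuration in which Consumer's budget $B'$ satisfies $B'\ge\mathrm{Th}'(v)$, where $v$ is the current vertex, and for every initial energy $M\in\mathbb{N}$, $M$-wins from that configuration. -/

import Mathlib

namespace DiscreteBidding

/-- The set `ℕ* = {0, 0*, 1, 1*, …}` of budgets and bids: an integral part `int`, and a flag `adv`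
that is `true` when the tie-breaking advantage `*` is attached. -/
@[ext]
structure StarNat where
  int : ℕ
  adv : Bool

namespace StarNat

/-- The position of an element in the enumeration `0, 0*, 1, 1*, …`. -/
def pos (x : StarNat) : ℕ := 2 * x.int + x.adv.toNat

theorem pos_injective : Function.Injective pos := by
  rintro ⟨x, a⟩ ⟨y, b⟩ h
  cases a <;> cases b <;> simp [pos] at h ⊢ <;> omega

/-- The order `0 ≺ 0* ≺ 1 ≺ 1* ≺ …`. -/
instance : LinearOrder StarNat := LinearOrder.lift' pos pos_injective

theorem le_iff_pos {x y : StarNat} : x ≤ y ↔ x.pos ≤ y.pos := Iff.rfl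

theorem lt_iff_pos {x y : StarNat} : x < y ↔ x.pos < y.pos := Iff.rfl

instance : WellFoundedLT StarNat := ⟨InvImage.wf pos wellFounded_lt⟩

/-- The successor in the order `≺`. -/
def succ : StarNat → StarNat
  | ⟨x, false⟩ => ⟨x, true⟩
  | ⟨x, true⟩ => ⟨x + 1, false⟩

/-- The operator `⊕`. -/
def oplus : StarNat → StarNat → StarNat
  | ⟨x, true⟩, ⟨y, false⟩ => ⟨x + y, true⟩
  | ⟨x, false⟩, ⟨y, true⟩ => ⟨x + y, true⟩
  | ⟨x, false⟩, ⟨y, false⟩ => ⟨x + y, false⟩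
  | ⟨x, true⟩, ⟨y, true⟩ => ⟨x + y + 1, false⟩

/-- The operator `⊖`. It is only applied to `B` and `b` with `b ≼ B`, where no truncated
subtraction occurs. -/
def ominus : StarNat → StarNat → StarNat
  | ⟨x, true⟩, ⟨y, false⟩ => ⟨x - y, true⟩
  | ⟨x, true⟩, ⟨y, true⟩ => ⟨x - y, false⟩
  | ⟨x, false⟩, ⟨y, false⟩ => ⟨x - y, false⟩
  | ⟨x, false⟩, ⟨y, true⟩ => ⟨x - y - 1, true⟩

theorem pos_oplus (x y : StarNat) : (x.oplus y).pos = x.pos + y.pos := by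
  rcases x with ⟨x, _ | _⟩ <;> rcases y with ⟨y, _ | _⟩ <;> simp [oplus, pos] <;> omega

theorem pos_ominus {x y : StarNat} (h : y ≤ x) : (x.ominus y).pos = x.pos - y.pos := by
  rw [le_iff_pos] at h
  rcases x with ⟨x, _ | _⟩ <;> rcases y with ⟨y, _ | _⟩ <;> simp [ominus, pos] at h ⊢ <;> omega

end StarNat

/-- An energy discrete-bidding game `⟨V, E, k, w⟩`: a directed graph in which every vertex has a
neighbor, integer weights on the edges (the value of `weight` off the edges is irrelevant), and the
total budget `k` (so that the two budgets always sum up to `k*`). -/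
structure EnergyGame (V : Type*) where
  edge : V → V → Prop
  exists_edge : ∀ v, ∃ u, edge v u
  weight : V → V → ℤ
  k : ℕ

namespace EnergyGame

variable {V : Type*} (G : EnergyGame V)

/-- The budget `k*`, the largest element of `[k] = {0, 0*, …, k, k*}`. -/
def maxBudget : StarNat := ⟨G.k, true⟩

/-- A configuration `⟨v, B⟩`: the token is on `v` and the budget of Preserver is `B ∈ [k]`. -/
structure Config where
  vertex : V
  budget : StarNat
  budget_le : budget ≤ G.maxBudget

variable {G}

/-- Consumer's budget `k* ⊖ B` in the configuration `⟨v, B⟩`. -/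
def Config.consBudget (c : G.Config) : StarNat := G.maxBudget.ominus c.budget

variable (G)

/-- The actions of a player with budget `B` when the token is on `v`: a bid that does not exceed
`B` and that is starred only if the player holds the advantage, and the neighbor of `v` to which
the player moves the token upon winning the bidding. -/
structure Action (v : V) (B : StarNat) where
  bid : StarNat
  target : V
  bid_le : bid ≤ B
  adv_of_adv : bid.adv = true → B.adv = true
  edge_target : G.edge v target

variable {G}

/-- Preserver wins the bidding if her bid is higher, or if the bids are equal and Consumer is the
one who holds the advantage (equal bids mean that its holder does not use it). -/
def PresWinsBidding (c : G.Config) (a : G.Action c.vertex c.budget)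
    (b : G.Action c.vertex c.consBudget) : Prop :=
  b.bid < a.bid ∨ (a.bid = b.bid ∧ c.budget.adv = false)

instance (c : G.Config) (a : G.Action c.vertex c.budget) (b : G.Action c.vertex c.consBudget) :
    Decidable (PresWinsBidding c a b) :=
  inferInstanceAs (Decidable (_ ∨ (_ ∧ _)))

/-- The transition function: the winner of the bidding pays his bid to the other player and moves
the token. Here `a` is the action of Preserver and `b` that of Consumer. -/
def next (c : G.Config) (a : G.Action c.vertex c.budget) (b : G.Action c.vertex c.consBudget) :
    G.Config :=
  if PresWinsBidding c a b then
    { vertex := a.target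
      budget := c.budget.ominus a.bid
      budget_le := by
        have h := c.budget_le
        rw [StarNat.le_iff_pos] at h ⊢
        rw [StarNat.pos_ominus a.bid_le]
        omega }
  else
    { vertex := b.target
      budget := c.budget.oplus b.bid
      budget_le := by
        have h := c.budget_le
        have h' : b.bid ≤ G.maxBudget.ominus c.budget := b.bid_le
        rw [StarNat.le_iff_pos, StarNat.pos_ominus h] at h'
        rw [StarNat.le_iff_pos] at h ⊢
        rw [StarNat.pos_oplus]
        omega }

variable (G)

/-- A (pure) strategy of Preserver: given the history, i.e. the list of the earlier configurations
followed by the current configuration `c`, it chooses an allowed action. -/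
abbrev PresStrategy := (past : List G.Config) → (c : G.Config) → G.Action c.vertex c.budget

/-- A (pure) strategy of Consumer. -/
abbrev ConsStrategy := (past : List G.Config) → (c : G.Config) → G.Action c.vertex c.consBudget

variable {G}

/-- The history after `n` turns of the play from `c₀` under the strategies `σ` and `τ`: the
configurations in turns `0, …, n - 1`, and the configuration in turn `n`. -/
def history (σ : G.PresStrategy) (τ : G.ConsStrategy) (c₀ : G.Config) :
    ℕ → List G.Config × G.Config
  | 0 => ([], c₀)
  | n + 1 =>
    let h := history σ τ c₀ n
    (h.1 ++ [h.2], next h.2 (σ h.1 h.2) (τ h.1 h.2))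

/-- The path in the graph that corresponds to the play from `c₀` under `σ` and `τ`. -/
def path (σ : G.PresStrategy) (τ : G.ConsStrategy) (c₀ : G.Config) (n : ℕ) : V :=
  (history σ τ c₀ n).2.vertex

variable (G)

/-- The energy, i.e. the sum of the weights, of the prefix of length `m` of a path. -/
def sumWeights (p : ℕ → V) (m : ℕ) : ℤ := ∑ j ∈ Finset.range m, G.weight (p j) (p (j + 1))

variable {G}

/-- The strategy `σ` of Preserver `M`-wins from `c`: against every strategy of Consumer, the energy
stays non-negative throughout. -/
def PresStrategy.Wins (σ : G.PresStrategy) (M : ℤ) (c : G.Config) : Prop :=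
  ∀ τ : G.ConsStrategy, ∀ m : ℕ, 0 ≤ M + G.sumWeights (path σ τ c) m

/-- The strategy `τ` of Consumer `M`-wins from `c`: against every strategy of Preserver, the energy
becomes negative at some point. -/
def ConsStrategy.Wins (τ : G.ConsStrategy) (M : ℤ) (c : G.Config) : Prop :=
  ∀ σ : G.PresStrategy, ∃ m : ℕ, M + G.sumWeights (path σ τ c) m < 0

/-- Preserver `M`-wins from `c`. -/
def PresWins (M : ℤ) (c : G.Config) : Prop := ∃ σ : G.PresStrategy, PresStrategy.Wins σ M c

/-- Consumer `M`-wins from `c`. -/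
def ConsWins (M : ℤ) (c : G.Config) : Prop := ∃ τ : G.ConsStrategy, ConsStrategy.Wins τ M c

/-- The energy threshold of a configuration: the least initial energy with which Preserver wins,
and `∞` if she loses with every initial energy. -/
noncomputable def energy (c : G.Config) : ℕ∞ := ⨅ (M : ℕ) (_ : PresWins (M : ℤ) c), (M : ℕ∞)

/-- The two-sided description of an energy threshold: it is an initial energy that suffices for
Preserver, while anything less suffices for Consumer. -/
def IsEnergyThreshold (c : G.Config) (e : ℕ∞) : Prop :=
  (∀ M : ℕ, e = M → PresWins (M : ℤ) c ∧ ConsWins ((M : ℤ) - 1) c) ∧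
    (e = ⊤ → ∀ M : ℕ, ConsWins (M : ℤ) c)

/-- A two-sided energy threshold, when there is one, is the one given by `energy`. -/
theorem IsEnergyThreshold.eq_energy {c : G.Config} {e : ℕ∞} (h : IsEnergyThreshold c e) :
    e = energy c := by
  have key : ∀ {N M : ℤ}, N ≤ M → PresWins N c → ConsWins M c → False := by
    rintro N M hNM ⟨σ, hσ⟩ ⟨τ, hτ⟩
    obtain ⟨m, hm⟩ := hτ σ
    have := hσ τ m
    omega
  induction e with
  | top =>
    refine (le_antisymm le_top (le_iInf₂ fun M hM => ?_)).symm
    exact (key le_rfl hM (h.2 rfl M)).elim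
  | coe e =>
    obtain ⟨h₁, h₂⟩ := h.1 e rfl
    refine le_antisymm (le_iInf₂ fun M hM => ?_) (iInf₂_le e h₁)
    by_contra hlt
    have hlt' : M < e := by exact_mod_cast not_le.mp hlt
    exact key (by omega) hM h₂

variable (G)

/-- The budgets `B ∈ [k]` of Preserver for which the energy threshold of `⟨v, B⟩` is finite. -/
def finiteEnergyBudgets (v : V) : Set StarNat :=
  {B | ∃ hB : B ≤ G.maxBudget, energy (G := G) ⟨v, B, hB⟩ < ⊤}

open Classical in
/-- The threshold budget `Th(v) ∈ [k] ∪ {k + 1}`: the least budget for which the energy threshold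
is finite, and `k + 1` if there is none in `[k]`. -/
noncomputable def threshold (v : V) : StarNat :=
  if h : (G.finiteEnergyBudgets v).Nonempty then
    (wellFounded_lt (α := StarNat)).min (G.finiteEnergyBudgets v) h
  else ⟨G.k + 1, false⟩

/-- Consumer's threshold `Th'(v) = (k + 1) ⊖ Th(v)`. -/
noncomputable def consThreshold (v : V) : StarNat :=
  (⟨G.k + 1, false⟩ : StarNat).ominus (G.threshold v)

/-- The trimmed budget of Consumer at `⟨v, B'⟩`: whichever of `Th'(v)` and its successor agrees
with `B'` on the tie-breaking advantage. -/
noncomputable def consTrim (v : V) (B' : StarNat) : StarNat :=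
  if (G.consThreshold v).adv = B'.adv then G.consThreshold v else (G.consThreshold v).succ

variable {G}

/-- A strategy of Consumer is budget agnostic if, whenever his budget is at least his threshold, his
bid depends neither on the past nor on the excess budget: it is determined by the current vertex and
the trimmed budget. -/
def ConsStrategy.BudgetAgnostic (τ : G.ConsStrategy) : Prop :=
  ∀ (past₁ past₂ : List G.Config) (c₁ c₂ : G.Config), c₁.vertex = c₂.vertex →
    G.consThreshold c₁.vertex ≤ c₁.consBudget → G.consThreshold c₂.vertex ≤ c₂.consBudget →
    G.consTrim c₁.vertex c₁.consBudget = G.consTrim c₂.vertex c₂.consBudget →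
    (τ past₁ c₁).bid = (τ past₂ c₂).bid

end EnergyGame

end DiscreteBidding

/-! Through `pos`, ℕ* becomes ℕ, `oplus` and `ominus` become addition and subtraction, and holding
the advantage becomes oddness. Value iteration yields the energy that Preserver needs to survive n
turns; it is nondecreasing in n and nonincreasing in her budget. At each of the finitely many
configurations it stabilises or diverges, so at some stage a gap wider than every weight separates
the stable values from the others, and that stage is a potential for both players
(`exists_potential`).

Consumer needs strict progress, so this is applied to the weights N * w + 1, where N exceeds the
number of configurations. A bounded potential that rises by at least N * w + 1 per turn forces the
sums of w to -∞ (`wins_of_potential`), while Preserver loses nothing: dividing by N with a suitable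
offset absorbs the extra 1 (`exists_potential_of_perturbed`). Hence `Low` is exactly the set of
finite energy, and the thresholds are its boundary.

Consumer then plays the memoryless strategy so obtained as if his budget were trimmed. His excess
never shrinks: either it is unchanged and the old potential rises as before, or it grows, and a
large reward per unit of excess covers any loss (`exists_potential_trimmedStrategy`). -/

namespace DiscreteBidding

/-! ### Budgets, bids and turns in terms of positions in ℕ -/

namespace StarNat

/-- The element at a given position of the enumeration `0, 0*, 1, 1*, …`. -/
def ofPos (n : ℕ) : StarNat := ⟨n / 2, decide (n % 2 = 1)⟩

theorem pos_ofPos (n : ℕ) : (ofPos n).pos = n := by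
  rcases Nat.mod_two_eq_zero_or_one n with h | h <;> simp [ofPos, pos, h] <;> omega

theorem adv_iff (x : StarNat) : x.adv = true ↔ x.pos % 2 = 1 := by
  rcases x with ⟨x, _ | _⟩ <;> simp [pos]

theorem adv_eq_false_iff (x : StarNat) : x.adv = false ↔ x.pos % 2 = 0 := by
  rcases x with ⟨x, _ | _⟩ <;> simp [pos]

theorem adv_eq_iff (x y : StarNat) : x.adv = y.adv ↔ x.pos % 2 = y.pos % 2 := by
  rcases x with ⟨x, _ | _⟩ <;> rcases y with ⟨y, _ | _⟩ <;> simp [pos]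

theorem pos_succ (x : StarNat) : x.succ.pos = x.pos + 1 := by
  rcases x with ⟨x, _ | _⟩ <;> simp [succ, pos]; omega

end StarNat

namespace EnergyGame

open StarNat

variable {V : Type*} {G : EnergyGame V}

theorem pos_maxBudget : G.maxBudget.pos = 2 * G.k + 1 := by simp [maxBudget, pos]

theorem Config.pos_le (c : G.Config) : c.budget.pos ≤ 2 * G.k + 1 := by
  have h := c.budget_le
  rwa [le_iff_pos, pos_maxBudget] at h

theorem Config.pos_consBudget (c : G.Config) :
    c.consBudget.pos = 2 * G.k + 1 - c.budget.pos := by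
  rw [Config.consBudget, pos_ominus c.budget_le, pos_maxBudget]

theorem Config.ext_pos {c d : G.Config} (hv : c.vertex = d.vertex)
    (hB : c.budget.pos = d.budget.pos) : c = d := by
  obtain ⟨v, B, h⟩ := c
  obtain ⟨v', B', h'⟩ := d
  obtain rfl : v = v' := hv
  obtain rfl : B = B' := pos_injective hB
  rfl

/-- The configuration with a given vertex and position of Preserver's budget. -/
def Config.ofPos (v : V) (n : ℕ) (h : n ≤ 2 * G.k + 1) : G.Config :=
  ⟨v, StarNat.ofPos n, by rw [le_iff_pos, pos_ofPos, pos_maxBudget]; exact h⟩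

@[simp]
theorem Config.vertex_ofPos (v : V) (n : ℕ) (h : n ≤ 2 * G.k + 1) :
    (Config.ofPos (G := G) v n h).vertex = v := rfl

@[simp]
theorem Config.pos_budget_ofPos (v : V) (n : ℕ) (h : n ≤ 2 * G.k + 1) :
    (Config.ofPos (G := G) v n h).budget.pos = n := pos_ofPos n

instance [Finite V] : Finite G.Config := by
  refine Finite.of_injective
    (fun c : G.Config => (c.vertex, (⟨c.budget.pos, Nat.lt_succ_of_le c.pos_le⟩ :
      Fin (2 * G.k + 1).succ))) fun c d h => ?_
  simp only [Prod.mk.injEq, Fin.mk.injEq] at h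
  exact Config.ext_pos h.1 h.2

/-- The action whose bid has a given position. -/
def Action.ofPos {v : V} {B : StarNat} (n : ℕ) (u : V) (h : n ≤ B.pos)
    (hodd : n % 2 = 1 → B.pos % 2 = 1) (hu : G.edge v u) : G.Action v B where
  bid := StarNat.ofPos n
  target := u
  bid_le := by rw [le_iff_pos, pos_ofPos]; exact h
  adv_of_adv := by rw [adv_iff, adv_iff, pos_ofPos]; exact hodd
  edge_target := hu

@[simp]
theorem Action.pos_bid_ofPos {v : V} {B : StarNat} (n : ℕ) (u : V) (h : n ≤ B.pos)
    (hodd : n % 2 = 1 → B.pos % 2 = 1) (hu : G.edge v u) :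
    (Action.ofPos (G := G) n u h hodd hu).bid.pos = n := pos_ofPos n

@[simp]
theorem Action.target_ofPos {v : V} {B : StarNat} (n : ℕ) (u : V) (h : n ≤ B.pos)
    (hodd : n % 2 = 1 → B.pos % 2 = 1) (hu : G.edge v u) :
    (Action.ofPos (G := G) n u h hodd hu).target = u := rfl

theorem Action.pos_bid_le {v : V} {B : StarNat} (a : G.Action v B) : a.bid.pos ≤ B.pos := a.bid_le

theorem Action.odd_of_odd {v : V} {B : StarNat} (a : G.Action v B) (h : a.bid.pos % 2 = 1) :
    B.pos % 2 = 1 := by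
  rw [← adv_iff] at h ⊢
  exact a.adv_of_adv h

theorem presWinsBidding_iff (c : G.Config) (a : G.Action c.vertex c.budget)
    (b : G.Action c.vertex c.consBudget) :
    PresWinsBidding c a b ↔
      b.bid.pos < a.bid.pos ∨ (a.bid.pos = b.bid.pos ∧ c.budget.pos % 2 = 0) := by
  rw [PresWinsBidding, lt_iff_pos, adv_eq_false_iff, pos_injective.eq_iff]

theorem next_of_win {c : G.Config} {a : G.Action c.vertex c.budget}
    {b : G.Action c.vertex c.consBudget} (h : PresWinsBidding c a b) :
    (next c a b).vertex = a.target ∧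
      (next c a b).budget.pos = c.budget.pos - a.bid.pos := by
  rw [next, if_pos h]
  exact ⟨rfl, pos_ominus a.bid_le⟩

theorem next_of_not_win {c : G.Config} {a : G.Action c.vertex c.budget}
    {b : G.Action c.vertex c.consBudget} (h : ¬ PresWinsBidding c a b) :
    (next c a b).vertex = b.target ∧
      (next c a b).budget.pos = c.budget.pos + b.bid.pos := by
  rw [next, if_neg h]
  exact ⟨rfl, pos_oplus _ _⟩

/-! ### A single turn: determinacy and monotonicity in the budget -/

/-- Each turn is determined: if Preserver has no action that ensures `R`, then Consumer has one that
ensures its negation. Consumer beats the highest bid with which Preserver would reach `R`. -/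
theorem exists_consAction_of_not_presAction (R : G.Config → Prop) (c : G.Config)
    (h : ¬ ∃ a, ∀ b, R (next c a b)) : ∃ b, ∀ a, ¬ R (next c a b) := by
  push Not at h
  -- Once Preserver wins with bid n, the outcome no longer depends on Consumer's action, so being
  -- good is a property of n and her target alone.
  let good : ℕ → Prop := fun n => ∃ a : G.Action c.vertex c.budget, a.bid.pos = n ∧
    R (Config.ofPos a.target (c.budget.pos - n) (by have := c.pos_le; omega))
  have good_of_win : ∀ a b, PresWinsBidding c a b → R (next c a b) → good a.bid.pos := by
    intro a b hw hR
    refine ⟨a, rfl, ?_⟩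
    convert hR
    exact Config.ext_pos (next_of_win hw).1.symm (by simp [(next_of_win hw).2])
  by_cases hg : ∃ n, good n
  · obtain ⟨y, hy, hmax⟩ : ∃ y, good y ∧ ∀ n, good n → n ≤ y := by
      classical
      obtain ⟨n, hn⟩ := hg
      have hb : ∀ m, good m → m ≤ c.budget.pos := by
        rintro m ⟨a, rfl, -⟩
        exact a.pos_bid_le
      exact ⟨Nat.findGreatest good c.budget.pos, Nat.findGreatest_spec (hb n hn) hn,
        fun m hm => Nat.le_findGreatest (hb m hm) hm⟩
    obtain ⟨a, rfl, ha⟩ := hy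
    obtain ⟨b, hb⟩ := h a
    have hw : ¬ PresWinsBidding c a b := by
      intro hw
      refine hb ?_
      convert ha
      exact Config.ext_pos (next_of_win hw).1 (by simp [(next_of_win hw).2])
    -- The reply `b` beats the highest good bid, hence every good bid; and if Consumer wins, the
    -- outcome is the same against all her actions.
    refine ⟨b, fun a' hR => ?_⟩
    by_cases hw' : PresWinsBidding c a' b
    · have := hmax _ (good_of_win a' b hw' hR)
      rw [presWinsBidding_iff] at hw hw'
      omega
    · refine hb ?_
      convert hR using 1
      exact Config.ext_pos ((next_of_not_win hw).1.trans (next_of_not_win hw').1.symm)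
        ((next_of_not_win hw).2.trans (next_of_not_win hw').2.symm)
  · obtain ⟨u, hu⟩ := G.exists_edge c.vertex
    refine ⟨Action.ofPos 0 u (by simp) (by simp) hu, fun a' hR => hg ?_⟩
    by_cases hw' : PresWinsBidding c a' (Action.ofPos 0 u (by simp) (by simp) hu)
    · exact ⟨_, good_of_win _ _ hw' hR⟩
    -- Losing to the bid 0 means a tie at 0: no payment, so she could have reached the same
    -- configuration by winning with 0.
    · refine ⟨0, Action.ofPos 0 u (by simp) (by simp) hu, by simp, ?_⟩
      convert hR
      exact Config.ext_pos (by simp [(next_of_not_win hw').1])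
        (by simp [(next_of_not_win hw').2])

/-- A larger budget of Preserver lets her ensure at least as much in one turn. -/
theorem exists_presAction_of_budget_le (R : G.Config → Prop)
    (hR : ∀ c d : G.Config, c.vertex = d.vertex → c.budget.pos ≤ d.budget.pos → R c → R d)
    {c d : G.Config} (hv : c.vertex = d.vertex) (hB : c.budget.pos ≤ d.budget.pos)
    (h : ∃ a, ∀ b, R (next c a b)) : ∃ a, ∀ b, R (next d a b) := by
  obtain ⟨v, B, hBc⟩ := c
  obtain ⟨v', B', hBd⟩ := d
  obtain rfl : v = v' := hv
  set c : G.Config := ⟨v, B, hBc⟩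
  set d : G.Config := ⟨v, B', hBd⟩
  change B.pos ≤ B'.pos at hB
  obtain ⟨a, ha⟩ := h
  have hc := c.pos_le
  have hd := d.pos_le
  have hcc := c.pos_consBudget
  have hdc := d.pos_consBudget
  change B.pos ≤ _ at hc
  change B'.pos ≤ _ at hd
  change _ = 2 * G.k + 1 - B.pos at hcc
  change _ = 2 * G.k + 1 - B'.pos at hdc
  have hle : a.bid.pos ≤ B.pos := a.pos_bid_le
  have hodd : a.bid.pos % 2 = 1 → B.pos % 2 = 1 := a.odd_of_odd
  -- Whatever the bids, Preserver's own move is acceptable.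
  have key : ∀ e : G.Config, e.vertex = a.target → B.pos - a.bid.pos ≤ e.budget.pos → R e := by
    intro e he hpos
    -- Against the bid 0 aimed at her own target, she either wins or ties at 0, and the token goes
    -- to that target anyway.
    let b : G.Action c.vertex c.consBudget :=
      Action.ofPos 0 a.target (by simp) (by simp) a.edge_target
    have hb := ha b
    by_cases hw : PresWinsBidding c a b
    · exact hR _ _ ((next_of_win hw).1.trans he.symm) ((next_of_win hw).2.trans_le hpos) hb
    · refine hR _ _ ((next_of_not_win hw).1.trans he.symm) ?_ hb
      rw [(next_of_not_win hw).2]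
      rw [presWinsBidding_iff] at hw
      have : b.bid.pos = 0 := pos_ofPos 0
      change B.pos + _ ≤ _
      omega
  -- Here n replaces her bid, and each bid m that beats n at `d` is answered by a bid l that beats
  -- her old bid at `c` and leaves her no richer there.
  obtain ⟨n, hn, hnodd, hnge, hbeat⟩ : ∃ n, n ≤ B'.pos ∧ (n % 2 = 1 → B'.pos % 2 = 1) ∧
      B.pos - a.bid.pos ≤ B'.pos - n ∧
      ∀ m, m ≤ d.consBudget.pos → (m % 2 = 1 → d.consBudget.pos % 2 = 1) →
        ¬ (m < n ∨ n = m ∧ B'.pos % 2 = 0) →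
        ∃ l, l ≤ c.consBudget.pos ∧ (l % 2 = 1 → c.consBudget.pos % 2 = 1) ∧
          ¬ (l < a.bid.pos ∨ a.bid.pos = l ∧ B.pos % 2 = 0) ∧ B.pos + l ≤ B'.pos + m := by
    rw [hcc, hdc]
    by_cases hpar : B.pos % 2 = B'.pos % 2
    · exact ⟨a.bid.pos, by omega, by omega, by omega, fun m h1 h2 h3 =>
        ⟨m, by omega, by omega, by omega, by omega⟩⟩
    -- If she gains the advantage she now loses ties, so she stars her bid. If she gives it up she
    -- may not bid an odd position and rounds up, while winning ties.
    · by_cases hev : B.pos % 2 = 0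
      · exact ⟨a.bid.pos + 1, by omega, by omega, by omega, fun m h1 h2 h3 =>
          ⟨m, by omega, by omega, by omega, by omega⟩⟩
      · exact ⟨a.bid.pos + a.bid.pos % 2, by omega, by omega, by omega, fun m h1 h2 h3 =>
          ⟨a.bid.pos + a.bid.pos % 2, by omega, by omega, by omega, by omega⟩⟩
  refine ⟨Action.ofPos n a.target hn hnodd a.edge_target, fun b' => ?_⟩
  by_cases hw : PresWinsBidding d (Action.ofPos n a.target hn hnodd a.edge_target) b'
  · refine key _ (next_of_win hw).1 ?_
    rw [(next_of_win hw).2, Action.pos_bid_ofPos]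
    exact hnge
  · have hw' := hw
    rw [presWinsBidding_iff, Action.pos_bid_ofPos] at hw'
    obtain ⟨l, hl, hlodd, hlw, hlB⟩ := hbeat b'.bid.pos b'.pos_bid_le b'.odd_of_odd hw'
    let b : G.Action c.vertex c.consBudget := Action.ofPos l b'.target hl hlodd b'.edge_target
    have hwc : ¬ PresWinsBidding c a b := by
      rw [presWinsBidding_iff, Action.pos_bid_ofPos]
      exact hlw
    refine hR _ _ ((next_of_not_win hwc).1.trans (next_of_not_win hw).1.symm) ?_ (ha b)
    rw [(next_of_not_win hwc).2, (next_of_not_win hw).2, Action.pos_bid_ofPos]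
    exact hlB

/-! ### Finite-horizon energies and the potential -/

open Filter

/-- A nondecreasing sequence of functions on a finite type is, at some stage, stationary and bounded
by some `K` at some of the points and larger than `K + D` at the others. -/
theorem exists_stage_of_monotone {S : Type*} [Finite S] (e : ℕ → S → ℕ) (he : Monotone e) (D : ℕ) :
    ∃ n K, ∀ c, (e n c ≤ K ∧ e (n + 1) c = e n c) ∨ K + D < e n c := by
  have hlim : ∀ c, ∃ K, (∀ᶠ n in atTop, e n c = K) ∨ Tendsto (fun n => e n c) atTop atTop := by
    intro c
    rcases tendsto_atTop_of_monotone (fun _ _ h => he h c : Monotone fun n => e n c) with h | ⟨l, h⟩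
    · exact ⟨0, Or.inr h⟩
    · rw [nhds_discrete, tendsto_pure] at h
      exact ⟨l, Or.inl h⟩
  choose l hl using hlim
  obtain ⟨K, hK⟩ := (Set.finite_range l).bddAbove
  have hev : ∀ᶠ n in atTop, ∀ c, (e n c ≤ K ∧ e (n + 1) c = e n c) ∨ K + D < e n c := by
    rw [eventually_all]
    intro c
    rcases hl c with h | h
    · filter_upwards [h, (tendsto_add_atTop_nat 1).eventually h] with n h1 h2
      exact Or.inl ⟨h1 ▸ hK ⟨c, rfl⟩, h2.trans h1.symm⟩
    · filter_upwards [h.eventually_gt_atTop (K + D)] with n hn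
      exact Or.inr hn
  obtain ⟨n, hn⟩ := hev.exists
  exact ⟨n, K, hn⟩

theorem exists_abs_le_of_finite [Finite V] (w : V → V → ℤ) :
    ∃ D : ℕ, ∀ v u, |w v u| ≤ D := by
  obtain ⟨K, hK⟩ := (Set.finite_range fun p : V × V => |w p.1 p.2|).bddAbove
  exact ⟨K.toNat, fun v u => (hK ⟨(v, u), rfl⟩ : |w v u| ≤ K).trans (Int.self_le_toNat K)⟩

/-- Preserver has an action after which the energy requirement `e`, for the weights `w`, is met if
the current energy is `x`. -/
def Suffices (w : V → V → ℤ) (e : G.Config → ℕ) (c : G.Config) (x : ℕ) : Prop :=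
  ∃ a, ∀ b, (e (next c a b) : ℤ) ≤ x + w c.vertex (next c a b).vertex

theorem exists_suffices [Finite V] (w : V → V → ℤ) (e : G.Config → ℕ) (c : G.Config) :
    ∃ x, Suffices w e c x := by
  obtain ⟨D, hD⟩ := exists_abs_le_of_finite w
  obtain ⟨K, hK⟩ := (Set.finite_range e).bddAbove
  obtain ⟨u, hu⟩ := G.exists_edge c.vertex
  refine ⟨K + D, Action.ofPos 0 u (by simp) (by simp) hu, fun b => ?_⟩
  have h1 : e (next c (Action.ofPos 0 u (by simp) (by simp) hu) b) ≤ K := hK ⟨_, rfl⟩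
  have h2 := neg_le_of_abs_le
    (hD c.vertex (next c (Action.ofPos 0 u (by simp) (by simp) hu) b).vertex)
  push_cast
  omega

open Classical in
/-- The energy that Preserver needs to stay non-negative for `n` turns, for the weights `w`. -/
noncomputable def finiteEnergy [Finite V] (w : V → V → ℤ) : ℕ → G.Config → ℕ
  | 0 => fun _ => 0
  | n + 1 => fun c => Nat.find (exists_suffices w (finiteEnergy w n) c)

section finiteEnergy

variable [Finite V] (w : V → V → ℤ)

theorem suffices_finiteEnergy (n : ℕ) (c : G.Config) :
    Suffices w (finiteEnergy w n) c (finiteEnergy w (n + 1) c) := by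
  classical
  exact Nat.find_spec (exists_suffices w (finiteEnergy w n) c)

theorem finiteEnergy_succ_le {n : ℕ} {c : G.Config} {x : ℕ}
    (h : Suffices w (finiteEnergy w n) c x) : finiteEnergy w (n + 1) c ≤ x := by
  classical
  exact Nat.find_min' (exists_suffices w (finiteEnergy w n) c) h

theorem monotone_finiteEnergy : Monotone (finiteEnergy (G := G) w) := by
  refine monotone_nat_of_le_succ fun n => ?_
  induction n with
  | zero => exact fun c => Nat.zero_le _
  | succ n ih =>
    intro c
    obtain ⟨a, ha⟩ := suffices_finiteEnergy w (n + 1) c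
    exact finiteEnergy_succ_le w ⟨a, fun b => le_trans (by exact_mod_cast ih _) (ha b)⟩

/-- By induction on the horizon, meeting the remaining requirement is upward closed in Preserver's
budget, which is what `exists_presAction_of_budget_le` needs. -/
theorem finiteEnergy_anti (n : ℕ) {c d : G.Config} (hv : c.vertex = d.vertex)
    (hB : c.budget.pos ≤ d.budget.pos) : finiteEnergy w n d ≤ finiteEnergy w n c := by
  induction n generalizing c d with
  | zero => exact le_rfl
  | succ n ih =>
    refine finiteEnergy_succ_le w ?_
    have h : ∃ a, ∀ b, (finiteEnergy w n (next c a b) : ℤ) ≤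
        finiteEnergy w (n + 1) c + w d.vertex (next c a b).vertex := by
      rw [← hv]
      exact suffices_finiteEnergy w n c
    refine exists_presAction_of_budget_le
      (fun e => (finiteEnergy w n e : ℤ) ≤ finiteEnergy w (n + 1) c + w d.vertex e.vertex)
      (fun e e' hv' hB' h' => ?_) hv hB h
    have := ih hv' hB'
    rw [← hv']
    omega

end finiteEnergy

/-- The configurations split into `Low` and its complement, with a potential `E`, such that
Preserver can keep the token in `Low` while the potential rises at most by the weights, and Consumer
can keep it outside `Low` while the potential rises at least by the weights. -/
theorem exists_potential [Finite V] (G : EnergyGame V) (w : V → V → ℤ) :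
    ∃ (E : G.Config → ℕ) (Low : G.Config → Prop),
      (∀ c d : G.Config, c.vertex = d.vertex → c.budget.pos ≤ d.budget.pos → Low c → Low d) ∧
      (∀ c, Low c → ∃ a, ∀ b, Low (next c a b) ∧
        (E (next c a b) : ℤ) ≤ E c + w c.vertex (next c a b).vertex) ∧
      (∀ c, ¬ Low c → ∃ b, ∀ a, ¬ Low (next c a b) ∧
        E c + w c.vertex (next c a b).vertex ≤ (E (next c a b) : ℤ)) := by
  obtain ⟨D, hD⟩ := exists_abs_le_of_finite w
  obtain ⟨n, K, hn⟩ := exists_stage_of_monotone (finiteEnergy (G := G) w)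
    (monotone_finiteEnergy w) D
  refine ⟨finiteEnergy w n, fun c => finiteEnergy w n c ≤ K, fun c d hv hB h =>
    (finiteEnergy_anti w n hv hB).trans h, fun c hc => ?_, fun c hc => ?_⟩
  · have hst : finiteEnergy w (n + 1) c = finiteEnergy w n c := by
      rcases hn c with h | h
      · exact h.2
      · omega
    obtain ⟨a, ha⟩ := suffices_finiteEnergy w n c
    refine ⟨a, fun b => ?_⟩
    have hab := ha b
    have hw := le_of_abs_le (hD c.vertex (next c a b).vertex)
    rw [hst] at hab
    refine ⟨?_, hab⟩
    -- The new value is at most K + D, hence at most K by the gap.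
    rcases hn (next c a b) with h | h
    · exact h.1
    · omega
  · have hlarge : K + D < finiteEnergy w n c := by
      rcases hn c with h | h
      · exact absurd h.1 hc
      · exact h
    have hmono : finiteEnergy w n c ≤ finiteEnergy w (n + 1) c :=
      monotone_finiteEnergy w n.le_succ c
    -- The truncated subtraction is harmless, as the value exceeds K + D. Outside `Low` monotonicity
    -- in the horizon replaces stationarity.
    have hnot : ¬ Suffices w (finiteEnergy w n) c (finiteEnergy w (n + 1) c - 1) := fun h => by
      have := finiteEnergy_succ_le w h
      omega
    obtain ⟨b, hb⟩ := exists_consAction_of_not_presAction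
      (fun e => (finiteEnergy w n e : ℤ) ≤
        (finiteEnergy w (n + 1) c - 1 : ℕ) + w c.vertex e.vertex) c hnot
    refine ⟨b, fun a => ?_⟩
    have hab := hb a
    have hw := neg_le_of_abs_le (hD c.vertex (next c a b).vertex)
    constructor <;> omega

/-! ### From potentials to finite and infinite energy -/

/-- A potential for the weights `N * w + 1` that takes fewer than `N` values yields, after division
by `N` with a suitable offset, a potential for `w`. -/
theorem exists_potential_of_perturbed {S : Type*} [Finite S] (E : S → ℕ) {N : ℕ}
    (hN : Nat.card S < N) :
    ∃ g : S → ℤ, ∀ c d (w : ℤ), (E d : ℤ) ≤ E c + (N * w + 1) → g d ≤ g c + w := by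
  have : NeZero N := ⟨by omega⟩
  have hns : ¬ Function.Surjective fun c => ((E c + 1 : ℕ) : ZMod N) := fun h => by
    have := Nat.card_le_card_of_surjective _ h
    rw [Nat.card_zmod] at this
    omega
  -- Some residue r is missed by all `E c + 1`; measured from r, adding 1 never reaches a multiple
  -- of N, so the floor does not change.
  obtain ⟨r, hr⟩ := not_forall.mp hns
  have hNpos : (0 : ℤ) < N := by omega
  refine ⟨fun c => (E c - (r.val : ℤ)) / N, fun c d w h => ?_⟩
  have hdvd : ¬ (N : ℤ) ∣ (E c - (r.val : ℤ)) + 1 := by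
    intro hd
    rw [← ZMod.intCast_zmod_eq_zero_iff_dvd] at hd
    refine hr ⟨c, ?_⟩
    have : (E c : ZMod N) - r + 1 = 0 := by simpa using hd
    push_cast
    linear_combination this
  have h1 : (E d - (r.val : ℤ)) / N ≤ ((E c - (r.val : ℤ)) + 1 + N * w) / N :=
    Int.ediv_le_ediv hNpos (by omega)
  rw [Int.add_mul_ediv_left _ _ hNpos.ne'] at h1
  have h2 : ((E c - (r.val : ℤ)) + 1) / N ≤ (E c - (r.val : ℤ)) / N := by
    set x := (E c - (r.val : ℤ))
    rw [Int.le_ediv_iff_mul_le hNpos]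
    have h3 := Int.ediv_mul_le (x + 1) hNpos.ne'
    have h4 : (x + 1) / N * N ≠ x + 1 := fun h => hdvd ⟨(x + 1) / N, by rw [mul_comm]; exact h.symm⟩
    omega
  show (E d - (r.val : ℤ)) / N ≤ (E c - (r.val : ℤ)) / N + w
  omega

theorem sumWeights_succ (p : ℕ → V) (m : ℕ) :
    G.sumWeights p (m + 1) = G.sumWeights p m + G.weight (p m) (p (m + 1)) :=
  Finset.sum_range_succ _ _

instance (v : V) (B : StarNat) : Nonempty (G.Action v B) :=
  let ⟨u, hu⟩ := G.exists_edge v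
  ⟨Action.ofPos 0 u (by simp) (by simp) hu⟩

theorem exists_choice_consAction {P : G.Config → Prop}
    {Q : (c : G.Config) → G.Action c.vertex c.consBudget → Prop}
    (h : ∀ c, P c → ∃ b, Q c b) :
    ∃ f : (c : G.Config) → G.Action c.vertex c.consBudget, ∀ c, P c → Q c (f c) := by
  have h' : ∀ c, ∃ b, P c → Q c b := fun c => by
    by_cases hc : P c
    · obtain ⟨b, hb⟩ := h c hc
      exact ⟨b, fun _ => hb⟩
    · exact ⟨Classical.arbitrary _, fun hc' => absurd hc' hc⟩
  choose f hf using h'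
  exact ⟨f, hf⟩

/-- A potential that Preserver can keep from rising by more than the weights bounds the energy. -/
theorem energy_lt_top_of_potential [Finite V] (Low : G.Config → Prop) (g : G.Config → ℤ)
    (h : ∀ c, Low c → ∃ a, ∀ b, Low (next c a b) ∧
      g (next c a b) ≤ g c + G.weight c.vertex (next c a b).vertex)
    {c : G.Config} (hc : Low c) : energy c < ⊤ := by
  have h' : ∀ c, ∃ a, Low c → ∀ b, Low (next c a b) ∧
      g (next c a b) ≤ g c + G.weight c.vertex (next c a b).vertex := fun c => by
    by_cases hc : Low c
    · obtain ⟨a, ha⟩ := h c hc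
      exact ⟨a, fun _ => ha⟩
    · exact ⟨Classical.arbitrary _, fun hc' => absurd hc' hc⟩
  choose f hf using h'
  obtain ⟨K, hK⟩ := (Set.finite_range g).bddBelow
  -- The initial energy is the most that the potential can drop from its value at `c`.
  have hwin : PresWins ((g c - K).toNat : ℤ) c := by
    refine ⟨fun _ c => f c, fun τ m => ?_⟩
    have key : ∀ m, Low (history (fun _ c => f c) τ c m).2 ∧
        g (history (fun _ c => f c) τ c m).2 ≤
          g c + G.sumWeights (path (fun _ c => f c) τ c) m := by
      intro m
      induction m with
      | zero => exact ⟨hc, by simp [history, sumWeights]⟩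
      | succ m ih =>
        have hs := hf _ ih.1 (τ (history (fun _ c => f c) τ c m).1 _)
        refine ⟨hs.1, hs.2.trans ?_⟩
        rw [sumWeights_succ]
        have := ih.2
        simp only [path, history]
        omega
    have h1 := (key m).2
    have h2 : K ≤ g (history (fun _ c => f c) τ c m).2 := hK ⟨_, rfl⟩
    have h3 := Int.self_le_toNat (g c - K)
    omega
  exact lt_of_le_of_lt (b := (((g c - K).toNat : ℕ) : ℕ∞))
    (iInf₂_le (f := fun (M : ℕ) (_ : PresWins (M : ℤ) c) => (M : ℕ∞)) _ hwin)
    (ENat.natCast_lt_top _)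

/-- A Consumer strategy wins if there is a potential that rises by at least `N * w + 1` in every
turn, where `w` is the weight of the edge. -/
theorem wins_of_potential [Finite V] {τ : G.ConsStrategy} {Inv : G.Config → Prop}
    {Ψ : G.Config → ℤ} {N : ℕ}
    (h : ∀ past c a, Inv c → Inv (next c a (τ past c)) ∧
      Ψ c + (N * G.weight c.vertex (next c a (τ past c)).vertex + 1) ≤ Ψ (next c a (τ past c)))
    {c : G.Config} (hc : Inv c) (M : ℕ) : ConsStrategy.Wins τ (M : ℤ) c := by
  intro σ
  obtain ⟨K, hK⟩ := (Set.finite_range Ψ).bddAbove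
  have key : ∀ m : ℕ, Inv (history σ τ c m).2 ∧
      Ψ c + (N * G.sumWeights (path σ τ c) m + m) ≤ Ψ (history σ τ c m).2 := by
    intro m
    induction m with
    | zero => exact ⟨hc, by simp [history, sumWeights]⟩
    | succ m ih =>
      have hs := h (history σ τ c m).1 _ (σ (history σ τ c m).1 _) ih.1
      refine ⟨hs.1, le_trans ?_ hs.2⟩
      rw [sumWeights_succ]
      have := ih.2
      simp only [path, history]
      push_cast
      linarith
  by_contra! hcon
  -- At this turn, energy still non-negative would push the potential above its bound K.
  have h1 := (key (K - Ψ c + N * M + 1).toNat).2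
  have h2 : Ψ (history σ τ c (K - Ψ c + N * M + 1).toNat).2 ≤ K := hK ⟨_, rfl⟩
  have h3 := Int.self_le_toNat (K - Ψ c + N * M + 1)
  have h4 := hcon (K - Ψ c + N * M + 1).toNat
  have h5 : (0 : ℤ) ≤ N * (M + G.sumWeights (path σ τ c) (K - Ψ c + N * M + 1).toNat) :=
    mul_nonneg (by positivity) h4
  linarith

theorem energy_eq_top_of_consWins {c : G.Config} (h : ∀ M : ℕ, ConsWins (M : ℤ) c) :
    energy c = ⊤ :=
  (IsEnergyThreshold.eq_energy ⟨fun M hM => absurd hM (ENat.natCast_ne_top M).symm, fun _ => h⟩).symm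

/-! ### Thresholds and trimmed budgets -/

theorem pos_threshold_le (v : V) : (G.threshold v).pos ≤ 2 * G.k + 2 := by
  classical
  rw [threshold]
  split_ifs with h
  · obtain ⟨hB, -⟩ := wellFounded_lt.min_mem (G.finiteEnergyBudgets v) h
    rw [le_iff_pos, pos_maxBudget] at hB
    omega
  · simp only [pos, Bool.toNat_false]
    omega

theorem pos_consThreshold (v : V) :
    (G.consThreshold v).pos = 2 * G.k + 2 - (G.threshold v).pos := by
  have h := G.pos_threshold_le v
  have hp : (⟨G.k + 1, false⟩ : StarNat).pos = 2 * G.k + 2 := by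
    simp only [pos, Bool.toNat_false]
    omega
  rw [consThreshold, pos_ominus (by rw [le_iff_pos, hp]; exact h), hp]

theorem consThreshold_le_iff {c : G.Config} :
    G.consThreshold c.vertex ≤ c.consBudget ↔ c.budget.pos < (G.threshold c.vertex).pos := by
  have h1 := G.pos_threshold_le c.vertex
  have h2 := c.pos_le
  rw [le_iff_pos, pos_consThreshold, Config.pos_consBudget]
  omega

/-- Consumer's budget reaches his threshold exactly in a set of configurations that is closed under
raising his budget, provided that the energy is infinite exactly there. -/
theorem consThreshold_le_iff_not_low {Low : G.Config → Prop}
    (hmono : ∀ c d : G.Config, c.vertex = d.vertex → c.budget.pos ≤ d.budget.pos → Low c → Low d)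
    (hLow : ∀ c, Low c ↔ energy c < ⊤) (c : G.Config) :
    G.consThreshold c.vertex ≤ c.consBudget ↔ ¬ Low c := by
  classical
  rw [consThreshold_le_iff, ← not_le, not_iff_not, hLow]
  constructor
  · intro h
    rw [threshold] at h
    split_ifs at h with hne
    · obtain ⟨hB, he⟩ := wellFounded_lt.min_mem (G.finiteEnergyBudgets c.vertex) hne
      rw [← hLow] at he ⊢
      exact hmono ⟨c.vertex, _, hB⟩ c rfl h he
    · have := c.pos_le
      simp only [pos, Bool.toNat_false] at h this
      omega
  · intro h
    have hmem : c.budget ∈ G.finiteEnergyBudgets c.vertex := ⟨c.budget_le, h⟩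
    rw [threshold, dif_pos ⟨_, hmem⟩, ← le_iff_pos]
    exact not_lt.mp (wellFounded_lt.not_lt_min _ hmem)

theorem pos_consTrim (v : V) (B' : StarNat) :
    (G.consTrim v B').pos = if (G.consThreshold v).pos % 2 = B'.pos % 2 then
      (G.consThreshold v).pos else (G.consThreshold v).pos + 1 := by
  rw [consTrim]
  split_ifs with h1 h2 h2
  · rfl
  · exact absurd ((adv_eq_iff _ _).mp h1) h2
  · exact absurd ((adv_eq_iff _ _).mpr h2) h1
  · exact pos_succ _

/-- The configuration in which Consumer's budget is trimmed. -/
noncomputable def Config.trim (c : G.Config) : G.Config :=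
  Config.ofPos c.vertex (2 * G.k + 1 - (G.consTrim c.vertex c.consBudget).pos) (Nat.sub_le _ _)

/-- Trimming Consumer's budget raises Preserver's to the largest value below her threshold with the
same parity. -/
theorem Config.pos_budget_trim {c : G.Config} (h : G.consThreshold c.vertex ≤ c.consBudget) :
    c.budget.pos ≤ c.trim.budget.pos ∧ c.trim.budget.pos < (G.threshold c.vertex).pos ∧
      (G.threshold c.vertex).pos ≤ c.trim.budget.pos + 2 ∧
      c.trim.budget.pos % 2 = c.budget.pos % 2 := by
  rw [consThreshold_le_iff] at h
  have h1 := G.pos_threshold_le c.vertex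
  have h2 := c.pos_le
  rw [Config.trim, Config.pos_budget_ofPos, pos_consTrim, pos_consThreshold,
    Config.pos_consBudget]
  split_ifs <;> omega

theorem Config.pos_consBudget_trim_le {c : G.Config}
    (h : G.consThreshold c.vertex ≤ c.consBudget) :
    c.trim.consBudget.pos ≤ c.consBudget.pos ∧
      c.trim.consBudget.pos % 2 = c.consBudget.pos % 2 := by
  have h1 := Config.pos_budget_trim h
  have h2 := c.pos_le
  have h3 := c.trim.pos_le
  rw [Config.pos_consBudget, Config.pos_consBudget]
  omega

open Classical in
/-- The strategy that plays in every configuration as `f` plays with the trimmed budget. -/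
noncomputable def trimmedStrategy (f : (c : G.Config) → G.Action c.vertex c.consBudget) :
    G.ConsStrategy := fun _ c =>
  if h : G.consThreshold c.vertex ≤ c.consBudget then
    Action.ofPos (f c.trim).bid.pos (f c.trim).target
      ((f c.trim).pos_bid_le.trans (Config.pos_consBudget_trim_le h).1)
      (fun ho => (Config.pos_consBudget_trim_le h).2 ▸ (f c.trim).odd_of_odd ho)
      (f c.trim).edge_target
  else Classical.arbitrary _

theorem trimmedStrategy_pos_bid (f : (c : G.Config) → G.Action c.vertex c.consBudget)
    (past : List G.Config) {c : G.Config} (h : G.consThreshold c.vertex ≤ c.consBudget) :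
    (trimmedStrategy f past c).bid.pos = (f c.trim).bid.pos := by
  rw [trimmedStrategy, dif_pos h]
  exact Action.pos_bid_ofPos _ _ _ _ _

theorem trimmedStrategy_target (f : (c : G.Config) → G.Action c.vertex c.consBudget)
    (past : List G.Config) {c : G.Config} (h : G.consThreshold c.vertex ≤ c.consBudget) :
    (trimmedStrategy f past c).target = (f c.trim).target := by
  rw [trimmedStrategy, dif_pos h]
  rfl

theorem budgetAgnostic_trimmedStrategy
    (f : (c : G.Config) → G.Action c.vertex c.consBudget) :
    ConsStrategy.BudgetAgnostic (trimmedStrategy f) := by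
  intro past₁ past₂ c₁ c₂ hv h₁ h₂ htrim
  apply pos_injective
  rw [trimmedStrategy_pos_bid f past₁ h₁, trimmedStrategy_pos_bid f past₂ h₂]
  have : c₁.trim = c₂.trim :=
    Config.ext_pos hv (by
      rw [Config.trim, Config.trim, Config.pos_budget_ofPos, Config.pos_budget_ofPos, htrim])
  rw [this]

/-- A turn against the trimmed strategy is matched by one with the trimmed budgets, in which the
excess budget is left aside. -/
theorem exists_next_trim (f : (c : G.Config) → G.Action c.vertex c.consBudget)
    (past : List G.Config) {c : G.Config} (h : G.consThreshold c.vertex ≤ c.consBudget)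
    (a : G.Action c.vertex c.budget) :
    ∃ a', (next c.trim a' (f c.trim)).vertex = (next c a (trimmedStrategy f past c)).vertex ∧
      (next c.trim a' (f c.trim)).budget.pos + c.budget.pos =
        (next c a (trimmedStrategy f past c)).budget.pos + c.trim.budget.pos := by
  obtain ⟨h1, -, -, h4⟩ := Config.pos_budget_trim h
  -- Trimming preserves who holds the advantage, so the same bids are legal and ties break alike.
  let a' : G.Action c.trim.vertex c.trim.budget := Action.ofPos a.bid.pos a.target
    (a.pos_bid_le.trans h1) (fun ho => h4 ▸ a.odd_of_odd ho) a.edge_target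
  have ha : a'.bid.pos = a.bid.pos := Action.pos_bid_ofPos _ _ _ _ _
  have hb := trimmedStrategy_pos_bid f past h
  have hle := a.pos_bid_le
  have hiff : PresWinsBidding c.trim a' (f c.trim) ↔
      PresWinsBidding c a (trimmedStrategy f past c) := by
    rw [presWinsBidding_iff, presWinsBidding_iff, ha, hb, h4]
  refine ⟨a', ?_⟩
  by_cases hw : PresWinsBidding c a (trimmedStrategy f past c)
  · rw [(next_of_win hw).1, (next_of_win hw).2, (next_of_win (hiff.mpr hw)).1,
      (next_of_win (hiff.mpr hw)).2, ha]
    exact ⟨rfl, by omega⟩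
  · have hw' := mt hiff.mp hw
    rw [(next_of_not_win hw).1, (next_of_not_win hw).2, (next_of_not_win hw').1,
      (next_of_not_win hw').2, hb, trimmedStrategy_target f past h]
    exact ⟨rfl, by omega⟩

/-- If `f` raises the potential `E` by at least the weights `w`, then so does the trimmed strategy
for a potential that also rewards an increase of the excess budget. -/
theorem exists_potential_trimmedStrategy [Finite V] (w : V → V → ℤ) (E : G.Config → ℕ)
    (f : (c : G.Config) → G.Action c.vertex c.consBudget)
    (hf : ∀ c : G.Config, G.consThreshold c.vertex ≤ c.consBudget → ∀ a,
      G.consThreshold (next c a (f c)).vertex ≤ (next c a (f c)).consBudget ∧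
        E c + w c.vertex (next c a (f c)).vertex ≤ (E (next c a (f c)) : ℤ)) :
    ∃ Ψ : G.Config → ℤ, ∀ past (c : G.Config) a, G.consThreshold c.vertex ≤ c.consBudget →
      G.consThreshold (next c a (trimmedStrategy f past c)).vertex ≤
          (next c a (trimmedStrategy f past c)).consBudget ∧
        Ψ c + w c.vertex (next c a (trimmedStrategy f past c)).vertex ≤
          Ψ (next c a (trimmedStrategy f past c)) := by
  obtain ⟨D, hD⟩ := exists_abs_le_of_finite w
  obtain ⟨K, hK⟩ := (Set.finite_range E).bddAbove
  -- `K + D` bounds `E c.trim` plus any weight, so one unit of added excess outweighs whatever `E`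
  -- loses.
  refine ⟨fun c => E c.trim + (K + D : ℕ) * ((c.trim.budget.pos : ℤ) - c.budget.pos),
    fun past c a hc => ?_⟩
  obtain ⟨a', hv, hB⟩ := exists_next_trim f past hc a
  have hct := Config.pos_budget_trim hc
  obtain ⟨hthr, hE⟩ := hf c.trim (consThreshold_le_iff.mpr hct.2.1) a'
  have hw := le_of_abs_le (hD c.vertex (next c a (trimmedStrategy f past c)).vertex)
  rw [hv] at hE
  rw [consThreshold_le_iff, hv] at hthr
  set d := next c a (trimmedStrategy f past c)
  set e := next c.trim a' (f c.trim)
  have hd : G.consThreshold d.vertex ≤ d.consBudget := by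
    rw [consThreshold_le_iff]
    omega
  refine ⟨hd, ?_⟩
  have hdt := Config.pos_budget_trim hd
  -- Both lie below the threshold with the same parity, the excess being even, and `d.trim` is
  -- maximal among such configurations.
  have hle : e.budget.pos ≤ d.trim.budget.pos := by omega
  change (E c.trim : ℤ) + w c.vertex d.vertex ≤ E e at hE
  change (E c.trim : ℤ) + (K + D : ℕ) * ((c.trim.budget.pos : ℤ) - c.budget.pos) +
    w c.vertex d.vertex ≤ E d.trim + (K + D : ℕ) * ((d.trim.budget.pos : ℤ) - d.budget.pos)
  rcases hle.eq_or_lt with heq | hlt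
  · have hed : e = d.trim := Config.ext_pos hv heq
    have hx : (d.trim.budget.pos : ℤ) - d.budget.pos = c.trim.budget.pos - c.budget.pos := by
      omega
    rw [hx, ← hed]
    linarith
  · have hx : (c.trim.budget.pos : ℤ) - c.budget.pos + 1 ≤ d.trim.budget.pos - d.budget.pos := by
      omega
    have hmul := mul_le_mul_of_nonneg_left hx (Int.natCast_nonneg (K + D))
    have hEc : E c.trim ≤ K := hK ⟨_, rfl⟩
    rw [mul_add, mul_one] at hmul
    omega

/-- Consumer has a budget-agnostic strategy that wins, for every initial energy, wherever his budget
is at least his threshold. -/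
theorem exists_budgetAgnostic_wins [Finite V] (G : EnergyGame V) :
    ∃ τ : G.ConsStrategy, ConsStrategy.BudgetAgnostic τ ∧
      ∀ c : G.Config, G.consThreshold c.vertex ≤ c.consBudget →
        ∀ M : ℕ, ConsStrategy.Wins τ (M : ℤ) c := by
  set N := Nat.card G.Config + 1
  obtain ⟨E, Low, hmono, hpres, hcons⟩ :=
    exists_potential G (fun v u => N * G.weight v u + 1)
  obtain ⟨f, hf⟩ := exists_choice_consAction hcons
  -- The untrimmed `f` suffices to identify `Low`; only then are the thresholds, and with them
  -- trimming, tied to the potential.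
  have hLow : ∀ c, Low c ↔ energy c < ⊤ := by
    refine fun c => ⟨fun hc => ?_, fun hc => ?_⟩
    · obtain ⟨g, hg⟩ := exists_potential_of_perturbed E (Nat.lt_succ_self (Nat.card G.Config))
      refine energy_lt_top_of_potential Low g (fun c hc => ?_) hc
      obtain ⟨a, ha⟩ := hpres c hc
      exact ⟨a, fun b => ⟨(ha b).1, hg _ _ _ (ha b).2⟩⟩
    · by_contra hn
      refine hc.ne (energy_eq_top_of_consWins fun M => ⟨fun _ c => f c, ?_⟩)
      exact wins_of_potential (Inv := fun c => ¬ Low c) (Ψ := fun c => (E c : ℤ)) (N := N)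
        (fun _ c a hc => hf c hc a) hn M
  have hthr := consThreshold_le_iff_not_low hmono hLow
  obtain ⟨Ψ, hΨ⟩ := exists_potential_trimmedStrategy (fun v u => N * G.weight v u + 1) E f
    fun c hc a => by
      rw [hthr] at hc ⊢
      exact hf c hc a
  exact ⟨trimmedStrategy f, budgetAgnostic_trimmedStrategy f,
    fun c hc M => wins_of_potential hΨ hc M⟩

end EnergyGame

end DiscreteBidding

theorem mainTheorem5 {V : Type*} [Finite V] (G : DiscreteBidding.EnergyGame V) :
    ∃ τ : G.ConsStrategy,
      DiscreteBidding.EnergyGame.ConsStrategy.BudgetAgnostic τ ∧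
      ∀ c : G.Config, G.consThreshold c.vertex ≤ c.consBudget →
        ∀ M : ℕ, DiscreteBidding.EnergyGame.ConsStrategy.Wins τ (M : ℤ) c :=
  DiscreteBidding.EnergyGame.exists_budgetAgnostic_wins G
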